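/- Consider a two-user multiple-access channel with finite input alphabets $\mathcal X_1,\mathcal X_2$, finite output alphabet $\mathcal Y$ and transition probability $W(y|x_1,x_2)$, two independent sources with distributions $P_{U_1},P_{U_2}$ on finite alphabets, and, for each user $\nu=1,2$, two input distributions $Q_{\nu,1},Q_{\nu,2}$ on $\mathcal X_\nu$. For a source $P$ and a channel $V$ with input distribution $Q$ put $$E_s(\rho,P)=\log\Bigl(\sum_u P(u)^{\frac1{1+\rho}}\Bigr)^{1+\rho},\qquad E_0(\rho,Q,V)=-\log\sum_y\Bigl(\sum_x Q(x)V(y|x)^{\frac1{1+\rho}}\Bigr)^{1+\rho},$$ where sums, minima and maxima involving $P$ run over the $u$ with $P(u)>0$. For $\gamma\in[0,1]$ with $\min_u P(u)\le\gamma\le\max_u P(u)$ let $\rho_\gamma$ solve $$\frac{\sum_u P(u)^{s}\log P(u)}{\sum_u P(u)^{s}}=\log\gamma,\qquad s=\frac1{1+\rho_\gamma}\in\mathbb R,$$ and let $T_\gamma(\rho)=E_s(\rho_\gamma,P)+E_s'(\rho_\gamma,P)(\rho-\rho_\gamma)$ be the tangent to $E_s$ at $\rho_\gamma$ (understood as a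 limit of tangents if $s=0$, and if no finite solution exists, which happens only for non-uniform $P$ at $\gamma=\min_uP(u)$, where $s=-\infty$, and at $\gamma=\max_uP(u)$, where $s=+\infty$). Set $E_{s1}(\rho,P,\gamma)=E_s(\rho,P)$ if $\frac1{1+\rho}\ge\frac1{1+\rho_\gamma}$ and $T_\gamma(\rho)$ otherwise, and $E_{s2}(\rho,P,\gamma)=E_s(\rho,P)$ if $\frac1{1+\rho}<\frac1{1+\rho_\gamma}$ and $T_\gamma(\rho)$ otherwise. If $\gamma=0$ or $\gamma<\min_uP(u)$, then $E_{s1}=E_s$ and $E_{s2}=-\infty$; if $\gamma=1$ or $\gamma>\max_uP(u)$, then $E_{s1}=-\infty$ and $E_{s2}=E_s$. Let $\tau$ range over $\{1\},\{2\},\{1,2\}$. For $\tau=\{1\}$ or $\{2\}$, $WQ_{\tau^c,i}$ is the channel from $\mathcal X_\tau$ to $\mathcal X_{\tau^c}\times\mathcal Y$ with transition probability $W(y|x_1,x_2)Q_{\tau^c,i}(x_{\tau^c})$. For $\tau=\{1,2\}$, $Q_{\tau,i_\tau}$ is the product distribution $Q_{1,i_1}Q_{2,i_2}$, $WQ_{\tau^c,i}=W$,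 the set $\{Q_{\tau,1},Q_{\tau,2}\}$ means the set of the four products $Q_{1,i_1}Q_{2,i_2}$, the source functions $E_s$ and $E_{si}$ of $\tau$ are the sums of those of the two users, and terms and indices of $\tau^c=\emptyset$ are absent. For $\gamma_1,\gamma_2\in[0,1]$ let $$F_{\tau,i_\tau,i_{\tau^c}}(\gamma_1,\gamma_2)=\max_{\rho\in[0,1]}E_0(\rho,Q_{\tau,i_\tau},WQ_{\tau^c,i_{\tau^c}})-E_{si_\tau}(\rho,P_{U_\tau},\gamma_\tau)-E_{si_{\tau^c}}(0,P_{U_{\tau^c}},\gamma_{\tau^c}),$$ $$E=\max_{\gamma_1,\gamma_2\in[0,1]}\min_\tau\min_{i_\tau,i_{\tau^c}}F_{\tau,i_\tau,i_{\tau^c}}(\gamma_1,\gamma_2),\qquad E_\tau=\max_{\gamma_1,\gamma_2\in[0,1]}\min_{i_\tau,i_{\tau^c}}F_{\tau,i_\tau,i_{\tau^c}}(\gamma_1,\gamma_2).$$ Finally let $\bar E_0(\rho,\mathcal Q,V)$ be the concave hull of $E_0(\cdot,\mathcal Q,V)=\max_{Q\in\mathcal Q}E_0(\cdot,Q,V)$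 on $[0,1]$, i.e. the supremum of $\theta E_0(\rho_1,\mathcal Q,V)+(1-\theta)E_0(\rho_2,\mathcal Q,V)$ over $\theta,\rho_1,\rho_2\in[0,1]$ with $\theta\rho_1+(1-\theta)\rho_2=\rho$, and let $$F^{\rm U}_\tau=\max_{i_{\tau^c}=1,2}\ \max_{\rho\in[0,1]}\ \bar E_0(\rho,\{Q_{\tau,1},Q_{\tau,2}\},WQ_{\tau^c,i_{\tau^c}})-E_s(\rho,P_{U_\tau}),\qquad E_{\rm U}=\min_\tau F^{\rm U}_\tau .$$ Then $E\le E_{\rm U}$ and $E_\tau\le F^{\rm U}_\tau$ for every $\tau$, for every assignment of the two input distributions of each user to its two classes; in particular the exponent $E$ of the best of the four assignments is at most $E_{\rm U}$. For $\tau=\{1\}$ and $\tau=\{2\}$ the bound holds with equality for the best assignment: the maximum of $E_\tau$ over the four assignments equals $F^{\rm U}_\tau$. (All maxima over $\gamma_\nu$ and $\rho$ are read as suprema in $[-\infty,\infty]$.) -/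

import Mathlib

noncomputable section

namespace MACExponent

/-! ### Source functions -/

section Source

variable {U : Type*} [Fintype U]

/-- The symbols of positive probability; all sums, minima and cardinalities below that involve a
source are taken over these, so that symbols of probability zero play no role. -/
def supp (P : U → ℝ) : Finset U := Finset.univ.filter fun u => 0 < P u

/-- The power sum `∑ u, P(u) ^ s` over the support. -/
def powSum (P : U → ℝ) (s : ℝ) : ℝ := ∑ u ∈ supp P, P u ^ s

/-- Gallager's source function `E_s(ρ, P) = log (∑ u, P(u) ^ (1 / (1 + ρ))) ^ (1 + ρ)`. -/
def Es (P : U → ℝ) (ρ : ℝ) : ℝ := Real.log (powSum P (1 / (1 + ρ)) ^ (1 + ρ))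

/-- The quotient `(∑ u, P(u) ^ s log P(u)) / ∑ u, P(u) ^ s`. -/
def tiltedLogMean (P : U → ℝ) (s : ℝ) : ℝ :=
  (∑ u ∈ supp P, P u ^ s * Real.log (P u)) / powSum P s

/-- The smallest positive probability of a symbol. -/
def pmin (P : U → ℝ) : ℝ := ⨅ u : {u : U // 0 < P u}, P u

/-- The largest probability of a symbol. -/
def pmax (P : U → ℝ) : ℝ := ⨆ u : {u : U // 0 < P u}, P u

/-- The implicit equation for the tangency parameter `ρ_γ` has a solution, written in terms of
`s = 1 / (1 + ρ_γ)`, which ranges over all real numbers (`s = 0` is `ρ_γ = ∞`). -/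
def HasTilt (P : U → ℝ) (γ : ℝ) : Prop := ∃ s : ℝ, tiltedLogMean P s = Real.log γ

/-- A solution `s_γ = 1 / (1 + ρ_γ)` of the implicit equation. It is unique unless the source is
uniform on its support; in that case `E_s` is affine and all its tangents coincide with it. -/
def tilt (P : U → ℝ) (γ : ℝ) : ℝ := Classical.epsilon fun s : ℝ => tiltedLogMean P s = Real.log γ

/-- The value at `ρ` of the tangent to `E_s` at the point `ρ₀` with `1 / (1 + ρ₀) = s`, that is,
`E_s(ρ₀) + E_s'(ρ₀) (ρ - ρ₀)`. For `s = 0` (`ρ₀ = ∞`) it is the limit of these lines. -/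
def tangentEs (P : U → ℝ) (s ρ : ℝ) : ℝ :=
  if s = 0 then (1 + ρ) * Real.log ((supp P).card : ℝ) + tiltedLogMean P 0
  else Es P (1 / s - 1) + deriv (Es P) (1 / s - 1) * (ρ - (1 / s - 1))

/-- The limit of the tangents as `s → +∞` (for `c = pmax P`) or `s → -∞` (for `c = pmin P`). -/
def edgeEs (P : U → ℝ) (c ρ : ℝ) : ℝ :=
  (1 + ρ) * Real.log (((supp P).filter fun u => P u = c).card : ℝ) + Real.log c

open Classical in
/-- The source exponent function of the first class (the messages with `Pⁿ(u) ≥ γⁿ`). -/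
def Es₁ (P : U → ℝ) (γ ρ : ℝ) : EReal :=
  if γ = 1 ∨ pmax P < γ then ⊥
  else if γ = 0 ∨ γ < pmin P then (Es P ρ : EReal)
  else if HasTilt P γ then
    if tilt P γ ≤ 1 / (1 + ρ) then (Es P ρ : EReal) else (tangentEs P (tilt P γ) ρ : EReal)
  else if γ = pmax P then (edgeEs P (pmax P) ρ : EReal)
  else (Es P ρ : EReal)

open Classical in
/-- The source exponent function of the second class (the messages with `Pⁿ(u) < γⁿ`). -/
def Es₂ (P : U → ℝ) (γ ρ : ℝ) : EReal :=
  if γ = 1 ∨ pmax P < γ then (Es P ρ : EReal)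
  else if γ = 0 ∨ γ < pmin P then ⊥
  else if HasTilt P γ then
    if 1 / (1 + ρ) < tilt P γ then (Es P ρ : EReal) else (tangentEs P (tilt P γ) ρ : EReal)
  else if γ = pmin P then (edgeEs P (pmin P) ρ : EReal)
  else (Es P ρ : EReal)

/-- The source exponent function of class `i`; the indices `0, 1 : Fin 2` stand for the classes
`1, 2`. -/
def EsClass (P : U → ℝ) (i : Fin 2) (γ ρ : ℝ) : EReal :=
  if i = 0 then Es₁ P γ ρ else Es₂ P γ ρ

lemma powSum_pos {P : U → ℝ} (hP : P ∈ stdSimplex ℝ U) (s : ℝ) : 0 < powSum P s := by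
  have hne : (supp P).Nonempty := by
    by_contra h
    rw [Finset.not_nonempty_iff_eq_empty] at h
    have h0 : ∀ u, P u = 0 := by
      intro u
      have hu : u ∉ supp P := by simp [h]
      have := hP.1 u
      simp only [supp, Finset.mem_filter, Finset.mem_univ, true_and, not_lt] at hu
      linarith
    have := hP.2
    simp [h0] at this
  refine Finset.sum_pos (fun u hu => ?_) hne
  simp only [supp, Finset.mem_filter, Finset.mem_univ, true_and] at hu
  positivity

/-- The tangents to `E_s` in closed form; in particular, the value for `s = 0` is the continuous
extension of the others. -/
lemma tangentEs_eq {P : U → ℝ} (hP : P ∈ stdSimplex ℝ U) (s ρ : ℝ) :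
    tangentEs P s ρ =
      (1 + ρ) * (Real.log (powSum P s) - s * tiltedLogMean P s) + tiltedLogMean P s := by
  unfold tangentEs
  split_ifs with hs
  · subst hs
    simp [powSum]
  · have hEs : Es P = fun r => (1 + r) * Real.log (powSum P (1 / (1 + r))) := by
      funext r
      exact Real.log_rpow (powSum_pos hP _) _
    have h1 : 1 + (1 / s - 1) = 1 / s := by ring
    have h2 : 1 / (1 + (1 / s - 1)) = s := by rw [h1, one_div_one_div]
    have hpow : HasDerivAt (powSum P) (∑ u ∈ supp P, P u ^ s * Real.log (P u)) s := by
      unfold powSum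
      refine HasDerivAt.fun_sum fun u hu => ?_
      simp only [supp, Finset.mem_filter, Finset.mem_univ, true_and] at hu
      simpa [mul_comm] using (hasDerivAt_id s).const_rpow hu
    have hinv : HasDerivAt (fun r : ℝ => 1 / (1 + r)) (-(s ^ 2)) (1 / s - 1) := by
      have h := ((hasDerivAt_id (1 / s - 1)).const_add 1).inv (by simp [hs])
      have hfun : (fun r : ℝ => 1 / (1 + r)) = (fun r : ℝ => 1 + id r)⁻¹ := by
        funext r
        simp
      rw [hfun]
      have hval : -1 / (1 + id (1 / s - 1)) ^ 2 = -(s ^ 2) := by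
        rw [show 1 + id (1 / s - 1) = 1 / s from h1]
        field_simp
      rw [← hval]
      exact h
    have hlog : HasDerivAt (fun r : ℝ => Real.log (powSum P (1 / (1 + r))))
        (tiltedLogMean P s * -(s ^ 2)) (1 / s - 1) := by
      have hp : HasDerivAt (fun x => Real.log (powSum P x)) (tiltedLogMean P s) s :=
        hpow.log (powSum_pos hP s).ne'
      rw [← h2] at hp
      have := HasDerivAt.comp (1 / s - 1) hp hinv
      rwa [h2] at this
    have hD : HasDerivAt (Es P)
        (Real.log (powSum P s) + 1 / s * (tiltedLogMean P s * -(s ^ 2))) (1 / s - 1) := by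
      rw [hEs]
      have := ((hasDerivAt_id (1 / s - 1)).const_add 1).mul hlog
      simp only [id, one_mul, h1, one_div_one_div] at this
      exact this
    rw [hD.deriv, hEs]
    simp only [h1, one_div_one_div]
    field_simp
    ring

end Source

/-! ### Channel functions -/

section Channel

/-- Gallager's channel function
`E₀(ρ, Q, V) = - log ∑ y, (∑ x, Q(x) V(y|x) ^ (1 / (1 + ρ))) ^ (1 + ρ)`. -/
def E0 {X Y : Type*} [Fintype X] [Fintype Y] (ρ : ℝ) (Q : X → ℝ) (V : X → Y → ℝ) : ℝ :=
  -Real.log (∑ y, (∑ x, Q x * V x y ^ (1 / (1 + ρ))) ^ (1 + ρ))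

/-- The maximum of `E₀(ρ, Q, V)` over a (nonempty finite) set of input distributions. -/
def E0Max {X Y : Type*} [Fintype X] [Fintype Y] (ρ : ℝ) (𝒬 : Set (X → ℝ)) (V : X → Y → ℝ) : ℝ :=
  sSup ((fun Q => E0 ρ Q V) '' 𝒬)

/-- The concave hull on `[0, 1]`: the supremum of all convex combinations of two values. -/
def concaveHull (g : ℝ → ℝ) (ρ : ℝ) : EReal :=
  ⨆ (ρ₁ ∈ Set.Icc (0 : ℝ) 1) (ρ₂ ∈ Set.Icc (0 : ℝ) 1) (θ ∈ Set.Icc (0 : ℝ) 1)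
    (_ : θ * ρ₁ + (1 - θ) * ρ₂ = ρ), ((θ * g ρ₁ + (1 - θ) * g ρ₂ : ℝ) : EReal)

/-- The concave hull in `ρ` of the maximum of `E₀` over a set of input distributions. -/
def E0Bar {X Y : Type*} [Fintype X] [Fintype Y] (ρ : ℝ) (𝒬 : Set (X → ℝ)) (V : X → Y → ℝ) :
    EReal :=
  concaveHull (fun r => E0Max r 𝒬 V) ρ

variable {X₁ X₂ Y : Type*}

/-- The channel from user 1 to `X₂ × Y` with transition probability `W(y|x₁,x₂) Q(x₂)`. -/
def chan₁ (W : X₁ → X₂ → Y → ℝ) (Q : X₂ → ℝ) : X₁ → X₂ × Y → ℝ :=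
  fun x₁ z => W x₁ z.1 z.2 * Q z.1

/-- The channel from user 2 to `X₁ × Y` with transition probability `W(y|x₁,x₂) Q(x₁)`. -/
def chan₂ (W : X₁ → X₂ → Y → ℝ) (Q : X₁ → ℝ) : X₂ → X₁ × Y → ℝ :=
  fun x₂ z => W z.1 x₂ z.2 * Q z.1

/-- `W` as a point-to-point channel with input alphabet `X₁ × X₂`. -/
def chan₁₂ (W : X₁ → X₂ → Y → ℝ) : X₁ × X₂ → Y → ℝ := fun x => W x.1 x.2

/-- The product of two input distributions. -/
def prodDist (Q₁ : X₁ → ℝ) (Q₂ : X₂ → ℝ) : X₁ × X₂ → ℝ := fun x => Q₁ x.1 * Q₂ x.2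

end Channel

/-! ### The exponents -/

/-- The error types `{1}`, `{2}` and `{1, 2}`. -/
inductive ErrorType
  | user₁
  | user₂
  | both

section Exponents

variable {U₁ U₂ X₁ X₂ Y : Type*} [Fintype U₁] [Fintype U₂] [Fintype X₁] [Fintype X₂] [Fintype Y]
variable (P₁ : U₁ → ℝ) (P₂ : U₂ → ℝ) (W : X₁ → X₂ → Y → ℝ)
  (Q₁ : Fin 2 → X₁ → ℝ) (Q₂ : Fin 2 → X₂ → ℝ)

/-- `F_{τ, i_τ, i_{τᶜ}}(γ₁, γ₂)`; the class indices are given by user. For the type `{1, 2}`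
there is no term of `τᶜ = ∅`, and the two source functions are added. -/
def F (τ : ErrorType) (i₁ i₂ : Fin 2) (γ₁ γ₂ : ℝ) : EReal :=
  match τ with
  | .user₁ => ⨆ ρ ∈ Set.Icc (0 : ℝ) 1,
      (E0 ρ (Q₁ i₁) (chan₁ W (Q₂ i₂)) : EReal) - EsClass P₁ i₁ γ₁ ρ - EsClass P₂ i₂ γ₂ 0
  | .user₂ => ⨆ ρ ∈ Set.Icc (0 : ℝ) 1,
      (E0 ρ (Q₂ i₂) (chan₂ W (Q₁ i₁)) : EReal) - EsClass P₂ i₂ γ₂ ρ - EsClass P₁ i₁ γ₁ 0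
  | .both => ⨆ ρ ∈ Set.Icc (0 : ℝ) 1,
      (E0 ρ (prodDist (Q₁ i₁) (Q₂ i₂)) (chan₁₂ W) : EReal)
        - (EsClass P₁ i₁ γ₁ ρ + EsClass P₂ i₂ γ₂ ρ)

/-- The exponent `max_{γ₁, γ₂} min_τ min_{i₁, i₂} F`, for the assignment of `Q_{ν, i}` to the
class `i` of user `ν`. -/
def exponent : EReal :=
  ⨆ (γ₁ ∈ Set.Icc (0 : ℝ) 1) (γ₂ ∈ Set.Icc (0 : ℝ) 1),
    ⨅ (τ : ErrorType) (i₁ : Fin 2) (i₂ : Fin 2), F P₁ P₂ W Q₁ Q₂ τ i₁ i₂ γ₁ γ₂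

/-- The exponent for the best of the four assignments of input distributions to classes. -/
def exponentOpt : EReal :=
  ⨆ (σ₁ : Equiv.Perm (Fin 2)) (σ₂ : Equiv.Perm (Fin 2)),
    exponent P₁ P₂ W (fun i => Q₁ (σ₁ i)) (fun i => Q₂ (σ₂ i))

/-- The exponent of a single error type, `max_{γ₁, γ₂} min_{i₁, i₂} F`. -/
def typeExponent (τ : ErrorType) : EReal :=
  ⨆ (γ₁ ∈ Set.Icc (0 : ℝ) 1) (γ₂ ∈ Set.Icc (0 : ℝ) 1),
    ⨅ (i₁ : Fin 2) (i₂ : Fin 2), F P₁ P₂ W Q₁ Q₂ τ i₁ i₂ γ₁ γ₂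

/-- The exponent of a single error type for the best assignment. -/
def typeExponentOpt (τ : ErrorType) : EReal :=
  ⨆ (σ₁ : Equiv.Perm (Fin 2)) (σ₂ : Equiv.Perm (Fin 2)),
    typeExponent P₁ P₂ W (fun i => Q₁ (σ₁ i)) (fun i => Q₂ (σ₂ i)) τ

/-- The bound `F^U_τ`. For the type `{1, 2}` the set of input distributions consists of the four
products `Q_{1, i₁} Q_{2, i₂}`. -/
def FU (τ : ErrorType) : EReal :=
  match τ with
  | .user₁ => ⨆ (i₂ : Fin 2), ⨆ ρ ∈ Set.Icc (0 : ℝ) 1,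
      E0Bar ρ {Q₁ 0, Q₁ 1} (chan₁ W (Q₂ i₂)) - (Es P₁ ρ : EReal)
  | .user₂ => ⨆ (i₁ : Fin 2), ⨆ ρ ∈ Set.Icc (0 : ℝ) 1,
      E0Bar ρ {Q₂ 0, Q₂ 1} (chan₂ W (Q₁ i₁)) - (Es P₂ ρ : EReal)
  | .both => ⨆ ρ ∈ Set.Icc (0 : ℝ) 1,
      E0Bar ρ (Set.range fun i : Fin 2 × Fin 2 => prodDist (Q₁ i.1) (Q₂ i.2)) (chan₁₂ W)
        - ((Es P₁ ρ + Es P₂ ρ : ℝ) : EReal)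

/-- The upper bound `E_U = min_τ F^U_τ`. -/
def exponentUpper : EReal := ⨅ τ : ErrorType, FU P₁ P₂ W Q₁ Q₂ τ

end Exponents

end MACExponent

end

/-!
The parameter of a tangent to `E_s` at `ρ₀` is `s = 1 / (1 + ρ₀)`. In this parameter `E_s` and its
tangents are the perspectives of the convex function `s ↦ log (∑ u, P(u) ^ s)` and of its tangents
(`tangentEs_eq_mul`), so all comparisons between `E_s` and tangents follow from one inequality,
`log_powSum_tangent_le`. It gives the only property of the two class functions that the upper bound
needs: there is a threshold `a` such that the first class function lies above all tangents of
parameter at least `a`, and the second one above those of parameter at most `a`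
(`exists_isThreshold`).

Upper bound. If `E₀` exceeds each class function by more than `m` at some point, then either one of
these points lies where its class function is at least `E_s`, or the two points lie on either side
of the threshold. In the latter case both values of `E₀` exceed the common tangent by `m`, hence so
does the concave hull at the point of tangency, where the tangent is `E_s`
(`IsThreshold.exists_le_concaveHull`). For the error type `{1, 2}` there are two thresholds and
four class pairs, and the point of the pair that is exact between the thresholds determines the
second point (`IsThreshold.exists_le_concaveHull_add`). The term of the other user at `ρ = 0` is
harmless, because one of its class functions is at least `E_s(0) = 0` there.

Equality for one user. A point of the concave hull combines two values of `E₀`. If they belong to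
the same input distribution, the concavity of `E₀` (`E0_concaveOn`) makes the combination
superfluous, and `γ = 0` puts all messages into one class. Otherwise the distribution
used at the larger `ρ` is assigned to the first class and the other one to the second. As the
tangent moves, the distances of the two values to it vary continuously, while their weighted mean
is at least the value to be attained, since tangents lie below `E_s`. By the intermediate value
theorem either the two distances agree for some tangent, or already `γ = 0` or `γ = 1` suffices
(`exists_gamma_le`).
-/

namespace MACExponent

/-! ### Tangents to the source function -/

section Source

variable {U : Type*} [Fintype U] {P : U → ℝ}

lemma mem_supp {u : U} : u ∈ supp P ↔ 0 < P u := by simp [supp]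

lemma pmin_le {u : U} (hu : 0 < P u) : pmin P ≤ P u :=
  ciInf_le (Set.finite_range fun v : {v : U // 0 < P v} => P v).bddBelow ⟨u, hu⟩

lemma le_pmax {u : U} (hu : 0 < P u) : P u ≤ pmax P :=
  le_ciSup (Set.finite_range fun v : {v : U // 0 < P v} => P v).bddAbove ⟨u, hu⟩

lemma one_div_mem {ρ : ℝ} (hρ : ρ ∈ Set.Icc (0 : ℝ) 1) :
    1 / (1 + ρ) ∈ Set.Icc (1 / 2 : ℝ) 1 := by
  have hρ' : 0 < 1 + ρ := by linarith [hρ.1]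
  exact ⟨one_div_le_one_div_of_le hρ' (by linarith [hρ.2]),
    (div_le_one hρ').2 (by linarith [hρ.1])⟩

lemma exists_pos_mass (hP : P ∈ stdSimplex ℝ U) : ∃ u, 0 < P u := by
  by_contra! h
  have h1 : ∑ u, P u ≤ 0 := Finset.sum_nonpos fun u _ => h u
  linarith [hP.2]

lemma pmin_pos (hP : P ∈ stdSimplex ℝ U) : 0 < pmin P := by
  obtain ⟨u, hu⟩ := exists_pos_mass hP
  have : Nonempty {u : U // 0 < P u} := ⟨⟨u, hu⟩⟩
  obtain ⟨v, hv⟩ := exists_eq_ciInf_of_finite (f := fun v : {v : U // 0 < P v} => P v)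
  unfold pmin
  rw [← hv]
  exact v.2

lemma pmax_pos (hP : P ∈ stdSimplex ℝ U) : 0 < pmax P :=
  (exists_pos_mass hP).elim fun _ hu => hu.trans_le (le_pmax hu)

lemma le_one_of_mem (hP : P ∈ stdSimplex ℝ U) (u : U) : P u ≤ 1 :=
  hP.2 ▸ Finset.single_le_sum (fun v _ => hP.1 v) (Finset.mem_univ u)

lemma sum_eq_powSum_mul_tiltedLogMean (hP : P ∈ stdSimplex ℝ U) (s : ℝ) :
    ∑ u ∈ supp P, P u ^ s * Real.log (P u) = powSum P s * tiltedLogMean P s := by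
  have := (powSum_pos hP s).ne'
  unfold tiltedLogMean
  field_simp

lemma le_tiltedLogMean (hP : P ∈ stdSimplex ℝ U) {c : ℝ}
    (hc : ∀ u, 0 < P u → c ≤ Real.log (P u)) (s : ℝ) : c ≤ tiltedLogMean P s := by
  rw [tiltedLogMean, le_div_iff₀ (powSum_pos hP s), powSum, Finset.mul_sum]
  refine Finset.sum_le_sum fun u hu => ?_
  rw [mul_comm]
  have hu' := mem_supp.1 hu
  exact mul_le_mul_of_nonneg_left (hc u hu') (by positivity)

lemma tiltedLogMean_le (hP : P ∈ stdSimplex ℝ U) {c : ℝ}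
    (hc : ∀ u, 0 < P u → Real.log (P u) ≤ c) (s : ℝ) : tiltedLogMean P s ≤ c := by
  rw [tiltedLogMean, div_le_iff₀ (powSum_pos hP s), powSum, Finset.mul_sum]
  refine Finset.sum_le_sum fun u hu => ?_
  rw [mul_comm c]
  have hu' := mem_supp.1 hu
  exact mul_le_mul_of_nonneg_left (hc u hu') (by positivity)

/-- The logarithm of the power sum is convex, with derivative `tiltedLogMean P`: it lies above its
tangents. -/
lemma log_powSum_tangent_le (hP : P ∈ stdSimplex ℝ U) (s t : ℝ) :
    Real.log (powSum P s) + tiltedLogMean P s * (t - s) ≤ Real.log (powSum P t) := by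
  set c := (t - s) * tiltedLogMean P s with hc
  have key : Real.exp c * powSum P s ≤ powSum P t := by
    have h1 : ∑ u ∈ supp P, Real.exp c * (P u ^ s * (1 + (t - s) * Real.log (P u) - c))
        = Real.exp c * powSum P s := by
      rw [← Finset.mul_sum]
      congr 1
      have h2 : ∀ u, P u ^ s * (1 + (t - s) * Real.log (P u) - c)
          = (1 - c) * P u ^ s + (t - s) * (P u ^ s * Real.log (P u)) := fun u => by ring
      simp only [h2, Finset.sum_add_distrib, ← Finset.mul_sum,
        sum_eq_powSum_mul_tiltedLogMean hP]
      rw [hc, powSum]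
      ring
    rw [← h1, powSum]
    refine Finset.sum_le_sum fun u hu => ?_
    have hu' := mem_supp.1 hu
    have h3 : P u ^ t = Real.exp c * (P u ^ s * Real.exp ((t - s) * Real.log (P u) - c)) := by
      rw [Real.rpow_def_of_pos hu', Real.rpow_def_of_pos hu', ← Real.exp_add, ← Real.exp_add]
      congr 1
      ring
    rw [h3]
    have h4 := Real.add_one_le_exp ((t - s) * Real.log (P u) - c)
    gcongr
    linarith
  have h5 := Real.log_le_log (by have := powSum_pos hP s; positivity) key
  rw [Real.log_mul (Real.exp_pos _).ne' (powSum_pos hP s).ne', Real.log_exp] at h5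
  linarith

lemma tiltedLogMean_mono (hP : P ∈ stdSimplex ℝ U) : Monotone (tiltedLogMean P) := by
  intro s t hst
  have h1 := log_powSum_tangent_le hP s t
  have h2 := log_powSum_tangent_le hP t s
  rcases hst.eq_or_lt with rfl | hlt
  · rfl
  · by_contra! h
    nlinarith

/-- The tangent to `E_s` at `ρ`, evaluated at `ρ`; the point of tangency `ρ` corresponds to
`s = 1 / (1 + ρ)`. -/
lemma tangentEs_self (hP : P ∈ stdSimplex ℝ U) {ρ : ℝ} (hρ : 0 < 1 + ρ) :
    tangentEs P (1 / (1 + ρ)) ρ = Es P ρ := by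
  rw [tangentEs_eq hP, Es, Real.log_rpow (powSum_pos hP _)]
  field_simp
  ring

/-- The tangents to `E_s` are the perspectives of the tangents to the logarithm of the power
sum. -/
lemma tangentEs_eq_mul (hP : P ∈ stdSimplex ℝ U) (s : ℝ) {ρ : ℝ} (hρ : 0 < 1 + ρ) :
    tangentEs P s ρ = (1 + ρ) *
      (Real.log (powSum P s) + tiltedLogMean P s * (1 / (1 + ρ) - s)) := by
  rw [tangentEs_eq hP]
  field_simp
  ring

lemma tangentEs_le_Es (hP : P ∈ stdSimplex ℝ U) (s : ℝ) {ρ : ℝ} (hρ : 0 < 1 + ρ) :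
    tangentEs P s ρ ≤ Es P ρ := by
  rw [← tangentEs_self hP hρ, tangentEs_eq_mul hP s hρ, tangentEs_eq_mul hP _ hρ]
  have := log_powSum_tangent_le hP s (1 / (1 + ρ))
  exact mul_le_mul_of_nonneg_left (by linarith) hρ.le

/-- Among the tangents to `E_s`, the value at `ρ` decreases as the point of tangency moves away
from `ρ` on either side. -/
lemma tangentEs_le_tangentEs (hP : P ∈ stdSimplex ℝ U) {s a ρ : ℝ} (hρ : 0 < 1 + ρ)
    (h : 1 / (1 + ρ) ≤ a ∧ a ≤ s ∨ s ≤ a ∧ a ≤ 1 / (1 + ρ)) :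
    tangentEs P s ρ ≤ tangentEs P a ρ := by
  rw [tangentEs_eq_mul hP s hρ, tangentEs_eq_mul hP a hρ]
  have h1 := log_powSum_tangent_le hP s a
  refine mul_le_mul_of_nonneg_left ?_ hρ.le
  rcases h with ⟨h2, h3⟩ | ⟨h3, h2⟩
  · nlinarith [mul_nonneg (sub_nonneg.2 (tiltedLogMean_mono hP h3)) (sub_nonneg.2 h2)]
  · nlinarith [mul_nonneg (sub_nonneg.2 (tiltedLogMean_mono hP h3)) (sub_nonneg.2 h2)]

/-- Tangents to `E_s` with the same value of the tilted mean coincide, so it does not matter which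
solution of the implicit equation `tilt` selects. -/
lemma tangentEs_congr (hP : P ∈ stdSimplex ℝ U) {s s' : ℝ}
    (h : tiltedLogMean P s = tiltedLogMean P s') : tangentEs P s = tangentEs P s' := by
  funext ρ
  have h1 := log_powSum_tangent_le hP s s'
  have h2 := log_powSum_tangent_le hP s' s
  rw [← h] at h2
  rw [tangentEs_eq hP, tangentEs_eq hP, ← h]
  have : Real.log (powSum P s') = Real.log (powSum P s) + tiltedLogMean P s * (s' - s) := by
    linarith
  rw [this]
  ring

lemma Es_zero (hP : P ∈ stdSimplex ℝ U) : Es P 0 = 0 := by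
  have h : powSum P 1 = 1 := by
    refine Eq.trans ?_ hP.2
    rw [powSum, supp, Finset.sum_filter]
    refine Finset.sum_congr rfl fun u _ => ?_
    split_ifs with hu
    · simp
    · exact le_antisymm (hP.1 u) (not_lt.1 hu)
  simp [Es, h]

lemma tilt_spec {γ : ℝ} (h : HasTilt P γ) : tiltedLogMean P (tilt P γ) = Real.log γ :=
  Classical.epsilon_spec h

/-! ### The threshold between the two classes -/

/-- `a` is a threshold for the pair `S 0`, `S 1` of class functions of the source `P` if the first
one lies, on `[0, 1]`, above the tangents to `E_s` of parameter at least `a`, and the second one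
above those of parameter at most `a`. The parameter of a tangent is `s = 1 / (1 + ρ₀)`, for the
point of tangency `ρ₀`. -/
def IsThreshold (P : U → ℝ) (S : Fin 2 → ℝ → EReal) (a : ℝ) : Prop :=
  ∀ s ∈ Set.Icc (1 / 2 : ℝ) 1, ∀ ρ ∈ Set.Icc (0 : ℝ) 1,
    (a ≤ s → (tangentEs P s ρ : EReal) ≤ S 0 ρ) ∧ (s ≤ a → (tangentEs P s ρ : EReal) ≤ S 1 ρ)

lemma isThreshold_zero (hP : P ∈ stdSimplex ℝ U) {S : Fin 2 → ℝ → EReal}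
    (h : ∀ ρ, S 0 ρ = Es P ρ) : IsThreshold P S 0 := by
  intro s hs ρ hρ
  refine ⟨fun _ => ?_, fun h' => by linarith [hs.1]⟩
  rw [h]
  exact_mod_cast tangentEs_le_Es hP s (by linarith [hρ.1])

lemma isThreshold_two (hP : P ∈ stdSimplex ℝ U) {S : Fin 2 → ℝ → EReal}
    (h : ∀ ρ, S 1 ρ = Es P ρ) : IsThreshold P S 2 := by
  intro s hs ρ hρ
  refine ⟨fun h' => by linarith [hs.2], fun _ => ?_⟩
  rw [h]
  exact_mod_cast tangentEs_le_Es hP s (by linarith [hρ.1])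

lemma exists_isThreshold (hP : P ∈ stdSimplex ℝ U) (γ : ℝ) :
    ∃ a, IsThreshold P (fun i => EsClass P i γ) a := by
  by_cases h1 : γ = 1 ∨ pmax P < γ
  · exact ⟨2, isThreshold_two hP fun ρ => by simp [EsClass, Es₂, h1]⟩
  by_cases h2 : γ = 0 ∨ γ < pmin P
  · exact ⟨0, isThreshold_zero hP fun ρ => by simp [EsClass, Es₁, h1, h2]⟩
  by_cases h3 : HasTilt P γ
  · refine ⟨tilt P γ, fun s hs ρ hρ => ?_⟩
    have hρ' : 0 < 1 + ρ := by linarith [hρ.1]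
    simp only [EsClass, Es₁, Es₂, h1, h2, h3, if_true, if_false, one_ne_zero]
    refine ⟨fun h => ?_, fun h => ?_⟩
    · split_ifs with h4
      · exact_mod_cast tangentEs_le_Es hP s hρ'
      · exact_mod_cast tangentEs_le_tangentEs hP hρ' (Or.inl ⟨(not_le.1 h4).le, h⟩)
    · split_ifs with h4
      · exact_mod_cast tangentEs_le_Es hP s hρ'
      · exact_mod_cast tangentEs_le_tangentEs hP hρ' (Or.inr ⟨h, not_lt.1 h4⟩)
  by_cases h4 : γ = pmax P
  · -- A source with `pmin P = pmax P` is uniform on its support, and every `s` is a solution.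
    have h5 : γ ≠ pmin P := by
      intro h5
      have hlog : ∀ u, 0 < P u → Real.log (P u) = Real.log γ := fun u hu => by
        rw [le_antisymm ((le_pmax hu).trans_eq h4.symm) (h5.trans_le (pmin_le hu))]
      exact h3 ⟨0, le_antisymm (tiltedLogMean_le hP (fun u hu => (hlog u hu).le) 0)
        (le_tiltedLogMean hP (fun u hu => (hlog u hu).ge) 0)⟩
    exact ⟨2, isThreshold_two hP fun ρ => by
      simp only [EsClass, Es₂, h1, h2, h3, h5, if_false, one_ne_zero]⟩
  · exact ⟨0, isThreshold_zero hP fun ρ => by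
      simp only [EsClass, Es₁, h1, h2, h3, h4, if_true, if_false]⟩

/-- At every `ρ`, one of the two class functions is at least `E_s`. -/
lemma IsThreshold.exists_Es_le (hP : P ∈ stdSimplex ℝ U) {S : Fin 2 → ℝ → EReal} {a ρ : ℝ}
    (h : IsThreshold P S a) (hρ : ρ ∈ Set.Icc (0 : ℝ) 1) : ∃ i, (Es P ρ : EReal) ≤ S i ρ := by
  have hρ' : 0 < 1 + ρ := by linarith [hρ.1]
  have hs := one_div_mem hρ
  rw [← tangentEs_self hP hρ']
  rcases le_total a (1 / (1 + ρ)) with h' | h'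
  · exact ⟨0, (h _ hs ρ hρ).1 h'⟩
  · exact ⟨1, (h _ hs ρ hρ).2 h'⟩

end Source

/-! ### The upper bound -/

lemma le_concaveHull (g : ℝ → ℝ) {ρ x y θ : ℝ} (hx : x ∈ Set.Icc (0 : ℝ) 1)
    (hy : y ∈ Set.Icc (0 : ℝ) 1) (hθ : θ ∈ Set.Icc (0 : ℝ) 1) (h : θ * x + (1 - θ) * y = ρ) :
    ((θ * g x + (1 - θ) * g y : ℝ) : EReal) ≤ concaveHull g ρ := by
  unfold concaveHull
  exact le_iSup₂_of_le x hx <| le_iSup₂_of_le y hy <| le_iSup₂_of_le θ hθ <|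
    le_iSup_of_le h le_rfl

/-- If `g` exceeds an affine function by `m` at points on either side of `q`, so does its concave
hull at `q`. The points are compared through `s = 1 / (1 + q)`. -/
lemma add_le_concaveHull {g ℓ : ℝ → ℝ} {α β m s x y : ℝ} (hℓ : ∀ ρ, ℓ ρ = (1 + ρ) * α + β)
    (hx : x ∈ Set.Icc (0 : ℝ) 1) (hy : y ∈ Set.Icc (0 : ℝ) 1)
    (hxs : 1 / (1 + x) ≤ s) (hsy : s ≤ 1 / (1 + y))
    (hgx : m ≤ g x - ℓ x) (hgy : m ≤ g y - ℓ y) :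
    1 / s - 1 ∈ Set.Icc (0 : ℝ) 1 ∧
      ((m + ℓ (1 / s - 1) : ℝ) : EReal) ≤ concaveHull g (1 / s - 1) := by
  have hx' : 0 < 1 + x := by linarith [hx.1]
  have hy' : 0 < 1 + y := by linarith [hy.1]
  have hs : 0 < s := lt_of_lt_of_le (by positivity) hxs
  have h1 : 1 / s - 1 ≤ x := by
    have := one_div_le_one_div_of_le (by positivity) hxs
    rw [one_div_one_div] at this
    linarith
  have h2 : y ≤ 1 / s - 1 := by
    have := one_div_le_one_div_of_le hs hsy
    rw [one_div_one_div] at this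
    linarith
  set q := 1 / s - 1
  refine ⟨⟨hy.1.trans h2, h1.trans hx.2⟩, ?_⟩
  have hq : q ∈ segment ℝ y x := by
    rw [segment_eq_Icc (h2.trans h1)]
    exact ⟨h2, h1⟩
  obtain ⟨b, θ, hb, hθ, hbθ, hq⟩ := hq
  obtain rfl : b = 1 - θ := by linarith
  simp only [smul_eq_mul] at hq
  refine le_trans ?_ (le_concaveHull g hx hy ⟨hθ, by linarith⟩ (by linarith))
  refine EReal.coe_le_coe_iff.2 ?_
  have h3 : ℓ q = θ * ℓ x + (1 - θ) * ℓ y := by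
    rw [hℓ, hℓ, hℓ, ← hq]
    ring
  rw [h3]
  nlinarith [mul_le_mul_of_nonneg_left hgx hθ, mul_le_mul_of_nonneg_left hgy hb]

lemma le_sub_of_lt_sub {m G ℓ : ℝ} {S : EReal} (hS : (ℓ : EReal) ≤ S)
    (h : (m : EReal) < (G : EReal) - S) : m ≤ G - ℓ := by
  have : (m : EReal) < ((G - ℓ : ℝ) : EReal) := by
    rw [EReal.coe_sub]
    exact h.trans_le (EReal.sub_le_sub le_rfl hS)
  exact (EReal.coe_lt_coe_iff.1 this).le

/-- The upper bound for one user: if `g` exceeds both class functions by `m` somewhere, then its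
concave hull exceeds `E_s` by `m` somewhere. The two points are either separated by the threshold,
where they are joined over the common tangent, or one of them lies where its class function is
`E_s`. -/
lemma IsThreshold.exists_le_concaveHull {U : Type*} [Fintype U] {P : U → ℝ}
    (hP : P ∈ stdSimplex ℝ U) {S : Fin 2 → ℝ → EReal} {a m : ℝ} {g : ℝ → ℝ}
    (hS : IsThreshold P S a)
    (h : ∀ i, ∃ ρ ∈ Set.Icc (0 : ℝ) 1, (m : EReal) < (g ρ : EReal) - S i ρ) :
    ∃ q ∈ Set.Icc (0 : ℝ) 1, ((m + Es P q : ℝ) : EReal) ≤ concaveHull g q := by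
  have key : ∀ s x y : ℝ, x ∈ Set.Icc (0 : ℝ) 1 → y ∈ Set.Icc (0 : ℝ) 1 →
      1 / (1 + x) ≤ s → s ≤ 1 / (1 + y) → m ≤ g x - tangentEs P s x →
      m ≤ g y - tangentEs P s y →
      ∃ q ∈ Set.Icc (0 : ℝ) 1, ((m + Es P q : ℝ) : EReal) ≤ concaveHull g q := by
    intro s x y hx hy h1 h2 h3 h4
    obtain ⟨hq, hle⟩ := add_le_concaveHull (tangentEs_eq hP s) hx hy h1 h2 h3 h4
    have hself := tangentEs_self hP (ρ := 1 / s - 1) (by linarith [hq.1])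
    rw [show 1 / (1 + (1 / s - 1)) = s by rw [add_sub_cancel, one_div_one_div]] at hself
    exact ⟨_, hq, hself ▸ hle⟩
  obtain ⟨x, hx, hgx⟩ := h 0
  obtain ⟨y, hy, hgy⟩ := h 1
  have hsx := one_div_mem hx
  have hsy := one_div_mem hy
  by_cases h1 : a ≤ 1 / (1 + x)
  · have := le_sub_of_lt_sub ((hS _ hsx x hx).1 h1) hgx
    exact key _ x x hx hx le_rfl le_rfl this this
  by_cases h2 : 1 / (1 + y) ≤ a
  · have := le_sub_of_lt_sub ((hS _ hsy y hy).2 h2) hgy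
    exact key _ y y hy hy le_rfl le_rfl this this
  push Not at h1 h2
  have ha : a ∈ Set.Icc (1 / 2 : ℝ) 1 := ⟨hsx.1.trans h1.le, h2.le.trans hsy.2⟩
  exact key a x y hx hy h1.le h2.le (le_sub_of_lt_sub ((hS a ha x hx).1 le_rfl) hgx)
    (le_sub_of_lt_sub ((hS a ha y hy).2 le_rfl) hgy)

/-- The upper bound for two users, with thresholds `a ≤ b`. The point for the pair of classes
`(0, 1)`, which is the exact one between the thresholds, decides with which other point it is
joined: the one for `(1, 1)` across `a`, or the one for `(0, 0)` across `b`. -/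
lemma IsThreshold.exists_le_concaveHull_add {U U' : Type*} [Fintype U] [Fintype U']
    {P : U → ℝ} {P' : U' → ℝ} (hP : P ∈ stdSimplex ℝ U) (hP' : P' ∈ stdSimplex ℝ U')
    {S S' : Fin 2 → ℝ → EReal} {a b m : ℝ} {g : ℝ → ℝ}
    (hS : IsThreshold P S a) (hS' : IsThreshold P' S' b) (hab : a ≤ b)
    (h : ∀ i j, ∃ ρ ∈ Set.Icc (0 : ℝ) 1, (m : EReal) < (g ρ : EReal) - (S i ρ + S' j ρ)) :
    ∃ q ∈ Set.Icc (0 : ℝ) 1, ((m + (Es P q + Es P' q) : ℝ) : EReal) ≤ concaveHull g q := by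
  have key : ∀ s x y : ℝ, x ∈ Set.Icc (0 : ℝ) 1 → y ∈ Set.Icc (0 : ℝ) 1 →
      1 / (1 + x) ≤ s → s ≤ 1 / (1 + y) → m ≤ g x - (tangentEs P s x + tangentEs P' s x) →
      m ≤ g y - (tangentEs P s y + tangentEs P' s y) →
      ∃ q ∈ Set.Icc (0 : ℝ) 1,
        ((m + (Es P q + Es P' q) : ℝ) : EReal) ≤ concaveHull g q := by
    intro s x y hx hy h1 h2 h3 h4
    obtain ⟨hq, hle⟩ := add_le_concaveHull
      (ℓ := fun ρ => tangentEs P s ρ + tangentEs P' s ρ)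
      (α := (Real.log (powSum P s) - s * tiltedLogMean P s) +
        (Real.log (powSum P' s) - s * tiltedLogMean P' s))
      (β := tiltedLogMean P s + tiltedLogMean P' s)
      (fun ρ => by rw [tangentEs_eq hP, tangentEs_eq hP']; ring) hx hy h1 h2 h3 h4
    have hself := tangentEs_self hP (ρ := 1 / s - 1) (by linarith [hq.1])
    have hself' := tangentEs_self hP' (ρ := 1 / s - 1) (by linarith [hq.1])
    rw [show 1 / (1 + (1 / s - 1)) = s by rw [add_sub_cancel, one_div_one_div]] at hself hself'
    refine ⟨_, hq, ?_⟩
    rw [← hself, ← hself']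
    exact hle
  have val : ∀ {i j : Fin 2} {s ρ : ℝ},
      (tangentEs P s ρ : EReal) ≤ S i ρ → (tangentEs P' s ρ : EReal) ≤ S' j ρ →
      (m : EReal) < (g ρ : EReal) - (S i ρ + S' j ρ) →
      m ≤ g ρ - (tangentEs P s ρ + tangentEs P' s ρ) := fun h1 h2 =>
    le_sub_of_lt_sub (by rw [EReal.coe_add]; exact add_le_add h1 h2)
  obtain ⟨x, hx, hgx⟩ := h 0 1
  have hsx := one_div_mem hx
  rcases lt_or_ge (1 / (1 + x)) a with h1 | h1
  · obtain ⟨y, hy, hgy⟩ := h 1 1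
    have hsy := one_div_mem hy
    rcases le_or_gt (1 / (1 + y)) a with h2 | h2
    · have := val ((hS _ hsy y hy).2 h2) ((hS' _ hsy y hy).2 (h2.trans hab)) hgy
      exact key _ y y hy hy le_rfl le_rfl this this
    · have ha : a ∈ Set.Icc (1 / 2 : ℝ) 1 := ⟨hsx.1.trans h1.le, h2.le.trans hsy.2⟩
      exact key a x y hx hy h1.le h2.le
        (val ((hS a ha x hx).1 le_rfl) ((hS' a ha x hx).2 hab) hgx)
        (val ((hS a ha y hy).2 le_rfl) ((hS' a ha y hy).2 hab) hgy)
  rcases le_or_gt (1 / (1 + x)) b with h2 | h2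
  · have := val ((hS _ hsx x hx).1 h1) ((hS' _ hsx x hx).2 h2) hgx
    exact key _ x x hx hx le_rfl le_rfl this this
  · obtain ⟨y, hy, hgy⟩ := h 0 0
    have hsy := one_div_mem hy
    rcases le_or_gt b (1 / (1 + y)) with h3 | h3
    · have := val ((hS _ hsy y hy).1 (hab.trans h3)) ((hS' _ hsy y hy).1 h3) hgy
      exact key _ y y hy hy le_rfl le_rfl this this
    · have hb : b ∈ Set.Icc (1 / 2 : ℝ) 1 := ⟨hsy.1.trans h3.le, h2.le.trans hsx.2⟩
      exact key b y x hy hx h3.le h2.le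
        (val ((hS b hb y hy).1 hab) ((hS' b hb y hy).1 le_rfl) hgy)
        (val ((hS b hb x hx).1 hab) ((hS' b hb x hx).2 le_rfl) hgx)

/-! ### The bound for each error type -/

section Channel

variable {X Y : Type*} [Fintype X] [Fintype Y]

lemma E0_le_E0Max {ρ : ℝ} {𝒬 : Set (X → ℝ)} (h𝒬 : 𝒬.Finite) {Q : X → ℝ} (hQ : Q ∈ 𝒬)
    (V : X → Y → ℝ) : E0 ρ Q V ≤ E0Max ρ 𝒬 V :=
  le_csSup (h𝒬.image _).bddAbove ⟨Q, hQ, rfl⟩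

end Channel

lemma le_sub_coe_of_add_le {m e : ℝ} {H : EReal} (h : ((m + e : ℝ) : EReal) ≤ H) :
    (m : EReal) ≤ H - (e : EReal) := by
  rw [EReal.le_sub_iff_add_le (Or.inl (EReal.coe_ne_bot e)) (Or.inl (EReal.coe_ne_top e)),
    ← EReal.coe_add]
  exact h

section Exponents

variable {U₁ U₂ X₁ X₂ Y : Type*} [Fintype U₁] [Fintype U₂] [Fintype X₁] [Fintype X₂] [Fintype Y]
variable {P₁ : U₁ → ℝ} {P₂ : U₂ → ℝ} {W : X₁ → X₂ → Y → ℝ}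
  {Q₁ : Fin 2 → X₁ → ℝ} {Q₂ : Fin 2 → X₂ → ℝ}

/-- Exchanging the two users turns the error type `{2}` into `{1}`. -/
lemma typeExponent_user₂ : typeExponent P₁ P₂ W Q₁ Q₂ .user₂ =
    typeExponent P₂ P₁ (fun x₂ x₁ => W x₁ x₂) Q₂ Q₁ .user₁ := by
  have h : ∀ γ₁ γ₂, (⨅ (i₁ : Fin 2) (i₂ : Fin 2), F P₁ P₂ W Q₁ Q₂ .user₂ i₁ i₂ γ₁ γ₂) =
      ⨅ (i₂ : Fin 2) (i₁ : Fin 2),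
        F P₂ P₁ (fun x₂ x₁ => W x₁ x₂) Q₂ Q₁ .user₁ i₂ i₁ γ₂ γ₁ := fun _ _ => iInf_comm
  simp only [typeExponent, h]
  exact iSup₂_comm _

lemma typeExponentOpt_user₂ : typeExponentOpt P₁ P₂ W Q₁ Q₂ .user₂ =
    typeExponentOpt P₂ P₁ (fun x₂ x₁ => W x₁ x₂) Q₂ Q₁ .user₁ := by
  simp only [typeExponentOpt, typeExponent_user₂]
  exact iSup_comm

lemma FU_user₂ : FU P₁ P₂ W Q₁ Q₂ .user₂ =
    FU P₂ P₁ (fun x₂ x₁ => W x₁ x₂) Q₂ Q₁ .user₁ := rfl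

lemma typeExponent_user₁_le (hP₁ : P₁ ∈ stdSimplex ℝ U₁) (hP₂ : P₂ ∈ stdSimplex ℝ U₂) :
    typeExponent P₁ P₂ W Q₁ Q₂ .user₁ ≤ FU P₁ P₂ W Q₁ Q₂ .user₁ := by
  refine iSup₂_le fun γ₁ _ => iSup₂_le fun γ₂ _ => ?_
  by_contra! hlt
  obtain ⟨m, hm₁, hm₂⟩ := EReal.lt_iff_exists_real_btwn.1 hlt
  obtain ⟨a, ha⟩ := exists_isThreshold hP₁ γ₁
  obtain ⟨b, hb⟩ := exists_isThreshold hP₂ γ₂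
  obtain ⟨i₂, hi₂⟩ := hb.exists_Es_le hP₂ (ρ := 0) (by simp)
  rw [Es_zero hP₂] at hi₂
  obtain ⟨q, hq, hle⟩ := ha.exists_le_concaveHull hP₁ (m := m)
    (g := fun ρ => E0Max ρ {Q₁ 0, Q₁ 1} (chan₁ W (Q₂ i₂))) fun i₁ => by
      have hF : (m : EReal) < F P₁ P₂ W Q₁ Q₂ .user₁ i₁ i₂ γ₁ γ₂ :=
        hm₂.trans_le ((iInf_le _ i₁).trans (iInf_le _ i₂))
      simp only [F, lt_iSup_iff] at hF
      obtain ⟨ρ, hρ, hlt⟩ := hF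
      refine ⟨ρ, hρ, hlt.trans_le ((EReal.sub_le_sub le_rfl hi₂).trans ?_)⟩
      rw [EReal.coe_zero, sub_zero]
      refine EReal.sub_le_sub (EReal.coe_le_coe_iff.2 (E0_le_E0Max (by simp) ?_ _)) le_rfl
      fin_cases i₁ <;> simp
  refine absurd (le_sub_coe_of_add_le hle) (not_le.2 (lt_of_le_of_lt ?_ hm₁))
  exact le_iSup_of_le i₂ (le_iSup₂_of_le q hq le_rfl)

lemma typeExponent_both_le (hP₁ : P₁ ∈ stdSimplex ℝ U₁) (hP₂ : P₂ ∈ stdSimplex ℝ U₂) :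
    typeExponent P₁ P₂ W Q₁ Q₂ .both ≤ FU P₁ P₂ W Q₁ Q₂ .both := by
  refine iSup₂_le fun γ₁ _ => iSup₂_le fun γ₂ _ => ?_
  by_contra! hlt
  obtain ⟨m, hm₁, hm₂⟩ := EReal.lt_iff_exists_real_btwn.1 hlt
  obtain ⟨a, ha⟩ := exists_isThreshold hP₁ γ₁
  obtain ⟨b, hb⟩ := exists_isThreshold hP₂ γ₂
  set g : ℝ → ℝ := fun ρ =>
    E0Max ρ (Set.range fun i : Fin 2 × Fin 2 => prodDist (Q₁ i.1) (Q₂ i.2)) (chan₁₂ W)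
  have h : ∀ i₁ i₂, ∃ ρ ∈ Set.Icc (0 : ℝ) 1, (m : EReal) <
      (g ρ : EReal) - (EsClass P₁ i₁ γ₁ ρ + EsClass P₂ i₂ γ₂ ρ) := by
    intro i₁ i₂
    have hF : (m : EReal) < F P₁ P₂ W Q₁ Q₂ .both i₁ i₂ γ₁ γ₂ :=
      hm₂.trans_le ((iInf_le _ i₁).trans (iInf_le _ i₂))
    simp only [F, lt_iSup_iff] at hF
    obtain ⟨ρ, hρ, hlt⟩ := hF
    have hmem : prodDist (Q₁ i₁) (Q₂ i₂) ∈
        Set.range fun i : Fin 2 × Fin 2 => prodDist (Q₁ i.1) (Q₂ i.2) := ⟨(i₁, i₂), rfl⟩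
    have hmax := E0_le_E0Max (ρ := ρ) (Set.finite_range _) hmem (chan₁₂ W)
    exact ⟨ρ, hρ, hlt.trans_le (EReal.sub_le_sub (EReal.coe_le_coe_iff.2 hmax) le_rfl)⟩
  obtain ⟨q, hq, hle⟩ : ∃ q ∈ Set.Icc (0 : ℝ) 1,
      ((m + (Es P₁ q + Es P₂ q) : ℝ) : EReal) ≤ concaveHull g q := by
    rcases le_total a b with hab | hab
    · exact ha.exists_le_concaveHull_add hP₁ hP₂ hb hab h
    · simp only [add_comm (Es P₁ _)]
      exact hb.exists_le_concaveHull_add hP₂ hP₁ ha hab fun i₂ i₁ => by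
        simpa only [add_comm] using h i₁ i₂
  refine absurd (le_sub_coe_of_add_le hle) (not_le.2 (lt_of_le_of_lt ?_ hm₁))
  simp only [FU]
  exact le_iSup₂_of_le q hq le_rfl

theorem typeExponent_le (hP₁ : P₁ ∈ stdSimplex ℝ U₁) (hP₂ : P₂ ∈ stdSimplex ℝ U₂)
    (τ : ErrorType) : typeExponent P₁ P₂ W Q₁ Q₂ τ ≤ FU P₁ P₂ W Q₁ Q₂ τ := by
  cases τ with
  | user₁ => exact typeExponent_user₁_le hP₁ hP₂
  | user₂ => exact typeExponent_user₂.trans_le (typeExponent_user₁_le hP₂ hP₁)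
  | both => exact typeExponent_both_le hP₁ hP₂

theorem exponent_le (hP₁ : P₁ ∈ stdSimplex ℝ U₁) (hP₂ : P₂ ∈ stdSimplex ℝ U₂) :
    exponent P₁ P₂ W Q₁ Q₂ ≤ exponentUpper P₁ P₂ W Q₁ Q₂ :=
  le_iInf fun τ => le_trans (iSup₂_mono fun _ _ => iSup₂_mono fun _ _ => iInf_le _ τ)
    (typeExponent_le hP₁ hP₂ τ)

lemma pair_comp_perm {α : Type*} (f : Fin 2 → α) (σ : Equiv.Perm (Fin 2)) :
    ({f (σ 0), f (σ 1)} : Set α) = {f 0, f 1} := by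
  have h : ∀ g : Fin 2 → α, ({g 0, g 1} : Set α) = Set.range g := fun g => by
    ext
    simp [eq_comm]
  rw [h, h fun i => f (σ i)]
  exact σ.surjective.range_comp f

/-- The bounds do not depend on the assignment of the input distributions to the classes. -/
lemma FU_comp_perm (σ₁ σ₂ : Equiv.Perm (Fin 2)) (τ : ErrorType) :
    FU P₁ P₂ W (fun i => Q₁ (σ₁ i)) (fun i => Q₂ (σ₂ i)) τ = FU P₁ P₂ W Q₁ Q₂ τ := by
  cases τ with
  | user₁ =>
    simp only [FU, pair_comp_perm]
    exact σ₂.iSup_comp (g := fun i₂ => ⨆ ρ ∈ Set.Icc (0 : ℝ) 1,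
      E0Bar ρ {Q₁ 0, Q₁ 1} (chan₁ W (Q₂ i₂)) - (Es P₁ ρ : EReal))
  | user₂ =>
    simp only [FU, pair_comp_perm]
    exact σ₁.iSup_comp (g := fun i₁ => ⨆ ρ ∈ Set.Icc (0 : ℝ) 1,
      E0Bar ρ {Q₂ 0, Q₂ 1} (chan₂ W (Q₁ i₁)) - (Es P₂ ρ : EReal))
  | both =>
    have h : (Set.range fun i : Fin 2 × Fin 2 => prodDist (Q₁ (σ₁ i.1)) (Q₂ (σ₂ i.2))) =
        Set.range fun i : Fin 2 × Fin 2 => prodDist (Q₁ i.1) (Q₂ i.2) :=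
      (Equiv.prodCongr σ₁ σ₂).surjective.range_comp
        fun i : Fin 2 × Fin 2 => prodDist (Q₁ i.1) (Q₂ i.2)
    simp only [FU, h]

theorem exponentOpt_le (hP₁ : P₁ ∈ stdSimplex ℝ U₁) (hP₂ : P₂ ∈ stdSimplex ℝ U₂) :
    exponentOpt P₁ P₂ W Q₁ Q₂ ≤ exponentUpper P₁ P₂ W Q₁ Q₂ :=
  iSup₂_le fun σ₁ σ₂ => (exponent_le hP₁ hP₂).trans_eq <| by
    simp only [exponentUpper, FU_comp_perm]

lemma typeExponentOpt_le (hP₁ : P₁ ∈ stdSimplex ℝ U₁) (hP₂ : P₂ ∈ stdSimplex ℝ U₂)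
    (τ : ErrorType) : typeExponentOpt P₁ P₂ W Q₁ Q₂ τ ≤ FU P₁ P₂ W Q₁ Q₂ τ :=
  iSup₂_le fun σ₁ σ₂ => (typeExponent_le hP₁ hP₂ τ).trans_eq (FU_comp_perm σ₁ σ₂ τ)

end Exponents

/-! ### Concavity of the channel function -/

/-- Hölder's inequality for a product of complementary powers. -/
lemma sum_rpow_mul_rpow_le {ι : Type*} (s : Finset ι) {a b : ι → ℝ} (ha : ∀ i, 0 ≤ a i)
    (hb : ∀ i, 0 ≤ b i) {l r : ℝ} (hl : 0 ≤ l) (hr : 0 ≤ r) (hlr : l + r = 1) :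
    ∑ i ∈ s, a i ^ l * b i ^ r ≤ (∑ i ∈ s, a i) ^ l * (∑ i ∈ s, b i) ^ r := by
  rcases hl.eq_or_lt with rfl | hl
  · obtain rfl : r = 1 := by linarith
    simp
  rcases hr.eq_or_lt with rfl | hr
  · obtain rfl : l = 1 := by linarith
    simp
  have hc : (1 / l).HolderConjugate (1 / r) := by
    rw [Real.holderConjugate_iff]
    refine ⟨(one_lt_div hl).2 (by linarith), by simpa using hlr⟩
  have h := Real.inner_le_Lp_mul_Lq_of_nonneg s hc (f := fun i => a i ^ l) (g := fun i => b i ^ r)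
    (fun i _ => Real.rpow_nonneg (ha i) _) (fun i _ => Real.rpow_nonneg (hb i) _)
  have h1 : ∀ i, (a i ^ l) ^ (1 / l) = a i := fun i => by
    rw [← Real.rpow_mul (ha i), mul_one_div_cancel hl.ne', Real.rpow_one]
  have h2 : ∀ i, (b i ^ r) ^ (1 / r) = b i := fun i => by
    rw [← Real.rpow_mul (hb i), mul_one_div_cancel hr.ne', Real.rpow_one]
  simpa only [h1, h2, one_div_one_div] using h

section Channel

variable {X Y : Type*} [Fintype X] [Fintype Y]

lemma E0_sum_pos {Q : X → ℝ} (hQ : Q ∈ stdSimplex ℝ X) {V : X → Y → ℝ}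
    (hV : ∀ x, V x ∈ stdSimplex ℝ Y) (ρ : ℝ) :
    0 < ∑ y, (∑ x, Q x * V x y ^ (1 / (1 + ρ))) ^ (1 + ρ) := by
  obtain ⟨x, hx⟩ := exists_pos_mass hQ
  obtain ⟨y, hy⟩ := exists_pos_mass (hV x)
  have h0 : ∀ y x, 0 ≤ Q x * V x y ^ (1 / (1 + ρ)) := fun y x =>
    mul_nonneg (hQ.1 x) (Real.rpow_nonneg ((hV x).1 y) _)
  refine Finset.sum_pos' (fun y _ => Real.rpow_nonneg (Finset.sum_nonneg fun x _ => h0 y x) _)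
    ⟨y, Finset.mem_univ y, Real.rpow_pos_of_pos ?_ _⟩
  exact Finset.sum_pos' (fun x _ => h0 y x) ⟨x, Finset.mem_univ x, by positivity⟩

/-- The sum over the inputs in `E₀` is logarithmically convex in `ρ`. -/
lemma sum_rpow_le {Q v : X → ℝ} (hQ : ∀ x, 0 ≤ Q x) (hv : ∀ x, 0 ≤ v x) {r₁ r₂ l μ : ℝ}
    (hr₁ : 0 < r₁) (hr₂ : 0 < r₂) (hl : 0 ≤ l) (hμ : 0 ≤ μ) (hlμ : l + μ = 1) :
    (∑ x, Q x * v x ^ (1 / (l * r₁ + μ * r₂))) ^ (l * r₁ + μ * r₂) ≤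
      ((∑ x, Q x * v x ^ (1 / r₁)) ^ r₁) ^ l * ((∑ x, Q x * v x ^ (1 / r₂)) ^ r₂) ^ μ := by
  set r := l * r₁ + μ * r₂ with hr
  have hr0 : 0 < r := by
    rcases hl.eq_or_lt with rfl | hl
    · obtain rfl : μ = 1 := by linarith
      simpa [hr] using hr₂
    · positivity
  have h0 : ∀ (t : ℝ) x, 0 ≤ Q x * v x ^ t := fun t x =>
    mul_nonneg (hQ x) (Real.rpow_nonneg (hv x) _)
  have hS : ∀ t : ℝ, 0 ≤ ∑ x, Q x * v x ^ t := fun t => Finset.sum_nonneg fun x _ => h0 t x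
  have hsum : l * r₁ / r + μ * r₂ / r = 1 := by rw [← add_div, ← hr, div_self hr0.ne']
  have hterm : ∀ x, Q x * v x ^ (1 / r) =
      (Q x * v x ^ (1 / r₁)) ^ (l * r₁ / r) * (Q x * v x ^ (1 / r₂)) ^ (μ * r₂ / r) := by
    intro x
    have hv1 : 0 ≤ 1 / r₁ * (l * r₁ / r) := by positivity
    have hv2 : 0 ≤ 1 / r₂ * (μ * r₂ / r) := by positivity
    rw [Real.mul_rpow (hQ x) (Real.rpow_nonneg (hv x) _),
      Real.mul_rpow (hQ x) (Real.rpow_nonneg (hv x) _), ← Real.rpow_mul (hv x),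
      ← Real.rpow_mul (hv x), mul_mul_mul_comm, ← Real.rpow_add_of_nonneg (hQ x) (by positivity)
      (by positivity), ← Real.rpow_add_of_nonneg (hv x) hv1 hv2, hsum, Real.rpow_one]
    congr 2
    field_simp
    exact hlμ.symm
  have h := sum_rpow_mul_rpow_le Finset.univ (h0 (1 / r₁)) (h0 (1 / r₂))
    (l := l * r₁ / r) (r := μ * r₂ / r) (by positivity) (by positivity) hsum
  simp only [← hterm] at h
  refine (Real.rpow_le_rpow (hS _) h hr0.le).trans_eq ?_
  rw [Real.mul_rpow (Real.rpow_nonneg (hS _) _) (Real.rpow_nonneg (hS _) _),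
    ← Real.rpow_mul (hS _), ← Real.rpow_mul (hS _), ← Real.rpow_mul (hS _),
    ← Real.rpow_mul (hS _), div_mul_cancel₀ _ hr0.ne', div_mul_cancel₀ _ hr0.ne',
    mul_comm l, mul_comm μ]

/-- Gallager's function `E₀` is concave in `ρ`, by Hölder's inequality applied to the sum over the
inputs and to the sum over the outputs. -/
lemma E0_concaveOn {Q : X → ℝ} (hQ : Q ∈ stdSimplex ℝ X) {V : X → Y → ℝ}
    (hV : ∀ x, V x ∈ stdSimplex ℝ Y) :
    ConcaveOn ℝ (Set.Icc 0 1) fun ρ => E0 ρ Q V := by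
  refine ⟨convex_Icc 0 1, fun x hx y hy l μ hl hμ hlμ => ?_⟩
  have hx' : 0 < 1 + x := by linarith [hx.1]
  have hy' : 0 < 1 + y := by linarith [hy.1]
  have e : 1 + (l * x + μ * y) = l * (1 + x) + μ * (1 + y) := by linear_combination -hlμ
  have h0 : ∀ (t : ℝ) z, 0 ≤ (∑ x, Q x * V x z ^ (1 / (1 + t))) ^ (1 + t) := fun t z =>
    Real.rpow_nonneg (Finset.sum_nonneg fun x _ =>
      mul_nonneg (hQ.1 x) (Real.rpow_nonneg ((hV x).1 z) _)) _
  have h : ∑ z, (∑ w, Q w * V w z ^ (1 / (1 + (l * x + μ * y)))) ^ (1 + (l * x + μ * y)) ≤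
      (∑ z, (∑ w, Q w * V w z ^ (1 / (1 + x))) ^ (1 + x)) ^ l *
        (∑ z, (∑ w, Q w * V w z ^ (1 / (1 + y))) ^ (1 + y)) ^ μ := by
    refine le_trans (Finset.sum_le_sum fun z _ => ?_)
      (sum_rpow_mul_rpow_le Finset.univ (h0 x) (h0 y) hl hμ hlμ)
    rw [e]
    exact sum_rpow_le hQ.1 (fun w => (hV w).1 z) hx' hy' hl hμ hlμ
  have hpx := E0_sum_pos hQ hV x
  have hpy := E0_sum_pos hQ hV y
  have hlog := Real.log_le_log (E0_sum_pos hQ hV _) h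
  rw [Real.log_mul (Real.rpow_pos_of_pos hpx _).ne' (Real.rpow_pos_of_pos hpy _).ne',
    Real.log_rpow hpx, Real.log_rpow hpy] at hlog
  simp only [smul_eq_mul, E0]
  linarith

lemma chan₁_mem_stdSimplex {X₁ X₂ Y : Type*} [Fintype X₂] [Fintype Y] {W : X₁ → X₂ → Y → ℝ}
    (hW : ∀ x₁ x₂, W x₁ x₂ ∈ stdSimplex ℝ Y) {Q : X₂ → ℝ} (hQ : Q ∈ stdSimplex ℝ X₂) (x₁ : X₁) :
    chan₁ W Q x₁ ∈ stdSimplex ℝ (X₂ × Y) := by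
  refine ⟨fun z => mul_nonneg ((hW x₁ z.1).1 z.2) (hQ.1 z.1), ?_⟩
  simp only [chan₁, Fintype.sum_prod_type, ← Finset.sum_mul, (hW x₁ _).2, one_mul, hQ.2]

end Channel

/-! ### Attaining the bound -/

section Source

variable {U : Type*} [Fintype U] {P : U → ℝ}

lemma Es₁_zero (hP : P ∈ stdSimplex ℝ U) (ρ : ℝ) : Es₁ P 0 ρ = Es P ρ := by
  simp [Es₁, (pmax_pos hP).not_gt]

lemma Es₂_zero (hP : P ∈ stdSimplex ℝ U) (ρ : ℝ) : Es₂ P 0 ρ = ⊥ := by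
  simp [Es₂, (pmax_pos hP).not_gt]

lemma Es₁_one (ρ : ℝ) : Es₁ P 1 ρ = ⊥ := by simp [Es₁]

lemma Es₂_one (ρ : ℝ) : Es₂ P 1 ρ = Es P ρ := by simp [Es₂]

lemma EsClass_ne_top (i : Fin 2) (γ ρ : ℝ) : EsClass P i γ ρ ≠ ⊤ := by
  unfold EsClass Es₁ Es₂
  split_ifs <;> simp

lemma continuous_tangentEs (hP : P ∈ stdSimplex ℝ U) (ρ : ℝ) :
    Continuous fun s => tangentEs P s ρ := by
  have hpow : ∀ u ∈ supp P, Continuous fun s : ℝ => P u ^ s := fun u hu =>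
    Real.continuous_const_rpow (mem_supp.1 hu).ne'
  have h1 : Continuous (powSum P) := continuous_finsetSum _ hpow
  have h2 : Continuous (tiltedLogMean P) :=
    (continuous_finsetSum _ fun u hu => (hpow u hu).mul continuous_const).div h1
      fun s => (powSum_pos hP s).ne'
  simp only [tangentEs_eq hP]
  exact (continuous_const.mul ((h1.log fun s => (powSum_pos hP s).ne').sub
    (continuous_id.mul h2))).add h2

/-- If one tilted mean vanishes, the source has a single symbol, and they all vanish. -/
lemma tiltedLogMean_eq_zero (hP : P ∈ stdSimplex ℝ U) {s : ℝ} (h : tiltedLogMean P s = 0)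
    (t : ℝ) : tiltedLogMean P t = 0 := by
  have h0 : ∑ u ∈ supp P, P u ^ s * Real.log (P u) = 0 := by
    rw [sum_eq_powSum_mul_tiltedLogMean hP, h, mul_zero]
  rw [Finset.sum_eq_zero_iff_of_nonpos fun u hu => mul_nonpos_of_nonneg_of_nonpos
    (Real.rpow_nonneg (hP.1 u) s) (Real.log_nonpos (hP.1 u) (le_one_of_mem hP u))] at h0
  rw [tiltedLogMean, Finset.sum_eq_zero, zero_div]
  intro u hu
  rcases mul_eq_zero.1 (h0 u hu) with h1 | h1
  · exact absurd h1 (Real.rpow_pos_of_pos (mem_supp.1 hu) s).ne'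
  · rw [h1, mul_zero]

/-- Every tangent to `E_s` is the one in the class functions for some `γ`, except for a source with
a single symbol, where `γ` would be `1`, which stands for an empty first class. -/
lemma exists_gamma (hP : P ∈ stdSimplex ℝ U) {s x y : ℝ} (hx : 0 < 1 + x) (hy : 0 < 1 + y)
    (hs : tiltedLogMean P s ≠ 0) (hxs : 1 / (1 + x) ≤ s) (hsy : s ≤ 1 / (1 + y)) :
    ∃ γ ∈ Set.Icc (0 : ℝ) 1, Es₁ P γ x = tangentEs P s x ∧ Es₂ P γ y = tangentEs P s y := by
  set γ := Real.exp (tiltedLogMean P s) with hγ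
  have hle : tiltedLogMean P s ≤ 0 := tiltedLogMean_le hP
    (fun u hu => Real.log_nonpos hu.le (le_one_of_mem hP u)) s
  have hγ1 : γ < 1 := by
    rw [hγ, Real.exp_lt_one_iff]
    exact lt_of_le_of_ne hle hs
  have hγ0 : 0 < γ := Real.exp_pos _
  have hmax : γ ≤ pmax P := by
    rw [hγ, ← Real.le_log_iff_exp_le (pmax_pos hP)]
    exact tiltedLogMean_le hP (fun u hu => Real.log_le_log hu (le_pmax hu)) s
  have hmin : pmin P ≤ γ := by
    rw [hγ, ← Real.log_le_iff_le_exp (pmin_pos hP)]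
    exact le_tiltedLogMean hP (fun u hu => Real.log_le_log (pmin_pos hP) (pmin_le hu)) s
  have htilt : HasTilt P γ := ⟨s, by rw [hγ, Real.log_exp]⟩
  have hm : tiltedLogMean P (tilt P γ) = tiltedLogMean P s := by
    rw [tilt_spec htilt, hγ, Real.log_exp]
  -- The solution selected by `tilt` may differ from `s`; the tilted mean is constant in between.
  have hconst : ∀ {a b t : ℝ}, a ≤ t → t ≤ b → tiltedLogMean P a = tiltedLogMean P b →
      tiltedLogMean P t = tiltedLogMean P a := fun h1 h2 h3 =>
    le_antisymm (h3 ▸ tiltedLogMean_mono hP h2) (tiltedLogMean_mono hP h1)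
  have c1 : ¬(γ = 1 ∨ pmax P < γ) := by simp [hγ1.ne, hmax]
  have c2 : ¬(γ = 0 ∨ γ < pmin P) := by simp [hγ0.ne', hmin]
  refine ⟨γ, ⟨hγ0.le, hγ1.le⟩, ?_, ?_⟩
  · simp only [Es₁, c1, c2, htilt, if_true, if_false]
    split_ifs with h
    · rw [← tangentEs_self hP hx, tangentEs_congr hP ((hconst h hxs hm).trans hm)]
    · rw [tangentEs_congr hP hm]
  · simp only [Es₂, c1, c2, htilt, if_true, if_false]
    split_ifs with h
    · rw [← tangentEs_self hP hy, tangentEs_congr hP (hconst hsy h.le hm.symm)]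
    · rw [tangentEs_congr hP hm]

/-- Given values `α` at `x` and `β` at `y ≤ x`, assigned to the first and the second class, some
`γ` makes both at least as far above the class functions as their convex combination is above
`E_s`. If neither `γ = 0` nor `γ = 1` will do, `γ` is chosen such that the two distances agree:
their weighted mean is the distance of the chord to a tangent, hence at least that to `E_s`. -/
lemma exists_gamma_le (hP : P ∈ stdSimplex ℝ U) {x y θ α β : ℝ} (hy : 0 < 1 + y) (hyx : y ≤ x)
    (hθ : θ ∈ Set.Icc (0 : ℝ) 1) :
    ∃ γ ∈ Set.Icc (0 : ℝ) 1,
      ((θ * α + (1 - θ) * β - Es P (θ * x + (1 - θ) * y) : ℝ) : EReal) ≤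
        (α : EReal) - Es₁ P γ x ∧
      ((θ * α + (1 - θ) * β - Es P (θ * x + (1 - θ) * y) : ℝ) : EReal) ≤
        (β : EReal) - Es₂ P γ y := by
  have hx : 0 < 1 + x := by linarith
  have hθ' : 0 ≤ 1 - θ := by linarith [hθ.2]
  set v := θ * α + (1 - θ) * β - Es P (θ * x + (1 - θ) * y) with hv
  by_cases h1 : v ≤ α - Es P x
  · refine ⟨0, by simp, ?_, ?_⟩
    · rw [Es₁_zero hP, ← EReal.coe_sub]
      exact_mod_cast h1
    · simp [Es₂_zero hP]
  by_cases h2 : v ≤ β - Es P y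
  · refine ⟨1, by simp, ?_, ?_⟩
    · simp [Es₁_one]
    · rw [Es₂_one, ← EReal.coe_sub]
      exact_mod_cast h2
  push Not at h1 h2
  have hmean : ∀ s, v ≤ θ * (α - tangentEs P s x) + (1 - θ) * (β - tangentEs P s y) := by
    intro s
    have h := tangentEs_le_Es hP s (ρ := θ * x + (1 - θ) * y)
      (by nlinarith [mul_nonneg hθ.1 (sub_nonneg.2 hyx)])
    have e : tangentEs P s (θ * x + (1 - θ) * y) =
        θ * tangentEs P s x + (1 - θ) * tangentEs P s y := by
      simp only [tangentEs_eq hP]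
      ring
    rw [hv]
    linarith
  have hxy : 1 / (1 + x) ≤ 1 / (1 + y) := one_div_le_one_div_of_le hy (by linarith)
  obtain ⟨s, ⟨hxs, hsy⟩, hs⟩ := intermediate_value_Icc hxy
    (f := fun s => (α - tangentEs P s x) - (β - tangentEs P s y))
    ((continuous_const.sub (continuous_tangentEs hP x)).sub
      (continuous_const.sub (continuous_tangentEs hP y))).continuousOn
    (show (0 : ℝ) ∈ Set.Icc _ _ by
      constructor
      · have h := hmean (1 / (1 + x))
        rw [tangentEs_self hP hx] at h ⊢
        by_contra! hc
        nlinarith [mul_le_mul_of_nonneg_left hc.le hθ']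
      · have h := hmean (1 / (1 + y))
        rw [tangentEs_self hP hy] at h ⊢
        by_contra! hc
        nlinarith [mul_le_mul_of_nonneg_left hc.le hθ.1])
  have hs' : α - tangentEs P s x = β - tangentEs P s y := sub_eq_zero.1 hs
  have hα : v ≤ α - tangentEs P s x := by
    have h := hmean s
    rw [← hs'] at h
    linarith
  have hne : tiltedLogMean P s ≠ 0 := by
    intro h0
    rw [tangentEs_congr hP (h0.trans (tiltedLogMean_eq_zero hP h0 (1 / (1 + x))).symm),
      tangentEs_self hP hx] at hα
    linarith
  obtain ⟨γ, hγ, h₁, h₂⟩ := exists_gamma hP hx hy hne hxs hsy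
  refine ⟨γ, hγ, ?_, ?_⟩
  · rw [h₁, ← EReal.coe_sub]
    exact_mod_cast hα
  · rw [h₂, ← EReal.coe_sub]
    exact_mod_cast hs' ▸ hα

/-- A convex combination of values of two concave functions minus `E_s` is attained in both
classes, for a suitable `γ` and a suitable assignment of the functions to the classes. -/
lemma exists_assignment (hP : P ∈ stdSimplex ℝ U) {D : Fin 2 → ℝ → ℝ}
    (hD : ∀ i, ConcaveOn ℝ (Set.Icc 0 1) (D i)) {x y θ : ℝ} (hx : x ∈ Set.Icc (0 : ℝ) 1)
    (hy : y ∈ Set.Icc (0 : ℝ) 1) (hθ : θ ∈ Set.Icc (0 : ℝ) 1) (k l : Fin 2) :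
    ∃ γ ∈ Set.Icc (0 : ℝ) 1, ∃ σ : Equiv.Perm (Fin 2), ∀ i, ∃ ρ ∈ Set.Icc (0 : ℝ) 1,
      ((θ * D k x + (1 - θ) * D l y - Es P (θ * x + (1 - θ) * y) : ℝ) : EReal) ≤
        (D (σ i) ρ : EReal) - EsClass P i γ ρ := by
  have hθ' : 0 ≤ 1 - θ := by linarith [hθ.2]
  rcases eq_or_ne k l with rfl | hkl
  · refine ⟨0, by simp, Equiv.swap 0 k, fun i => ⟨θ * x + (1 - θ) * y,
      (hD k).1 hx hy hθ.1 hθ' (by ring), ?_⟩⟩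
    have hc := (hD k).2 hx hy hθ.1 hθ' (by ring)
    simp only [smul_eq_mul] at hc
    fin_cases i
    · simp only [EsClass, Fin.zero_eta, if_true, Es₁_zero hP, Equiv.swap_apply_left,
        ← EReal.coe_sub, EReal.coe_le_coe_iff]
      linarith
    · simp [EsClass, Es₂_zero hP]
  have hswap : ∀ {a b : Fin 2}, a ≠ b → Equiv.swap 0 a 1 = b := by decide
  rcases le_total y x with hyx | hxy
  · obtain ⟨γ, hγ, h₁, h₂⟩ := exists_gamma_le hP (α := D k x) (β := D l y)
      (by linarith [hy.1]) hyx hθ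
    refine ⟨γ, hγ, Equiv.swap 0 k, fun i => ?_⟩
    fin_cases i
    · exact ⟨x, hx, by simpa [EsClass] using h₁⟩
    · exact ⟨y, hy, by simpa [EsClass, hswap hkl] using h₂⟩
  · obtain ⟨γ, hγ, h₁, h₂⟩ := exists_gamma_le hP (α := D l y) (β := D k x) (θ := 1 - θ)
      (by linarith [hx.1]) hxy ⟨hθ', by linarith [hθ.1]⟩
    rw [sub_sub_cancel, add_comm, add_comm _ (θ * x)] at h₁ h₂
    refine ⟨γ, hγ, Equiv.swap 0 l, fun i => ?_⟩
    fin_cases i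
    · exact ⟨y, hy, by simpa [EsClass] using h₁⟩
    · exact ⟨x, hx, by simpa [EsClass, hswap hkl.symm] using h₂⟩

end Source

section Exponents

variable {U₁ U₂ X₁ X₂ Y : Type*} [Fintype U₁] [Fintype U₂] [Fintype X₁] [Fintype X₂] [Fintype Y]
variable {P₁ : U₁ → ℝ} {P₂ : U₂ → ℝ} {W : X₁ → X₂ → Y → ℝ}
  {Q₁ : Fin 2 → X₁ → ℝ} {Q₂ : Fin 2 → X₂ → ℝ}

lemma exists_E0Max_eq {X Y : Type*} [Fintype X] [Fintype Y] (Q : Fin 2 → X → ℝ) (V : X → Y → ℝ)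
    (ρ : ℝ) : ∃ k, E0Max ρ {Q 0, Q 1} V = E0 ρ (Q k) V := by
  obtain ⟨Q', hQ', h⟩ : E0Max ρ {Q 0, Q 1} V ∈ (fun Q => E0 ρ Q V) '' {Q 0, Q 1} :=
    ((Set.insert_nonempty _ _).image _).csSup_mem ((Set.toFinite {Q 0, Q 1}).image _)
  rcases hQ' with rfl | rfl
  · exact ⟨0, h.symm⟩
  · exact ⟨1, h.symm⟩

/-- The bound for the error type `{1}` is attained: with `γ₂ = 0`, all messages of the second user
are in the first class, to which the better of its two input distributions is assigned. -/
lemma FU_user₁_le (hP₁ : P₁ ∈ stdSimplex ℝ U₁) (hP₂ : P₂ ∈ stdSimplex ℝ U₂)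
    (hW : ∀ x₁ x₂, W x₁ x₂ ∈ stdSimplex ℝ Y) (hQ₁ : ∀ i, Q₁ i ∈ stdSimplex ℝ X₁)
    (hQ₂ : ∀ i, Q₂ i ∈ stdSimplex ℝ X₂) :
    FU P₁ P₂ W Q₁ Q₂ .user₁ ≤ typeExponentOpt P₁ P₂ W Q₁ Q₂ .user₁ := by
  refine iSup_le fun i₂ => iSup₂_le fun q _ => ?_
  rw [EReal.sub_le_iff_le_add (Or.inl (EReal.coe_ne_bot _)) (Or.inl (EReal.coe_ne_top _))]
  refine iSup₂_le fun x hx => iSup₂_le fun y hy => iSup₂_le fun θ hθ => iSup_le fun hq => ?_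
  rw [← EReal.sub_le_iff_le_add (Or.inl (EReal.coe_ne_bot _)) (Or.inl (EReal.coe_ne_top _)),
    ← EReal.coe_sub, ← hq]
  obtain ⟨k, hk⟩ := exists_E0Max_eq Q₁ (chan₁ W (Q₂ i₂)) x
  obtain ⟨l, hl⟩ := exists_E0Max_eq Q₁ (chan₁ W (Q₂ i₂)) y
  simp only [hk, hl]
  obtain ⟨γ, hγ, σ, h⟩ := exists_assignment hP₁
    (fun i => E0_concaveOn (hQ₁ i) (chan₁_mem_stdSimplex hW (hQ₂ i₂))) hx hy hθ k l
  refine le_iSup₂_of_le σ (Equiv.swap 0 i₂) <| le_iSup₂_of_le γ hγ <|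
    le_iSup₂_of_le 0 (by simp) <| le_iInf₂ fun j₁ j₂ => ?_
  obtain ⟨ρ, hρ, hle⟩ := h j₁
  refine le_iSup₂_of_le ρ hρ ?_
  fin_cases j₂
  · simpa [EsClass, Es₁_zero hP₂, Es_zero hP₂] using hle
  · have hne : ∀ c : ℝ, (c : EReal) - EsClass P₁ j₁ γ ρ ≠ ⊥ := fun c hc => by
      rw [sub_eq_add_neg] at hc
      rcases EReal.add_eq_bot_iff.1 hc with h' | h'
      · exact EReal.coe_ne_bot c h'
      · exact EsClass_ne_top j₁ γ ρ (EReal.neg_eq_bot_iff.1 h')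
    simp [EsClass.eq_1 P₂, Es₂_zero hP₂, EReal.sub_bot (hne _)]

end Exponents

end MACExponent

theorem proposition3 {U₁ U₂ X₁ X₂ Y : Type*}
    [Fintype U₁] [Fintype U₂] [Fintype X₁] [Fintype X₂] [Fintype Y]
    (P₁ : U₁ → ℝ) (hP₁ : P₁ ∈ stdSimplex ℝ U₁)
    (P₂ : U₂ → ℝ) (hP₂ : P₂ ∈ stdSimplex ℝ U₂)
    (W : X₁ → X₂ → Y → ℝ) (hW : ∀ x₁ x₂, W x₁ x₂ ∈ stdSimplex ℝ Y)
    (Q₁ : Fin 2 → X₁ → ℝ) (hQ₁ : ∀ i, Q₁ i ∈ stdSimplex ℝ X₁)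
    (Q₂ : Fin 2 → X₂ → ℝ) (hQ₂ : ∀ i, Q₂ i ∈ stdSimplex ℝ X₂) :
    -- the exponent, for the given and for the best assignment of distributions to classes
    MACExponent.exponent P₁ P₂ W Q₁ Q₂ ≤ MACExponent.exponentUpper P₁ P₂ W Q₁ Q₂ ∧
    MACExponent.exponentOpt P₁ P₂ W Q₁ Q₂ ≤ MACExponent.exponentUpper P₁ P₂ W Q₁ Q₂ ∧
    -- the bound for each error type
    (∀ τ, MACExponent.typeExponent P₁ P₂ W Q₁ Q₂ τ ≤ MACExponent.FU P₁ P₂ W Q₁ Q₂ τ) ∧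
    -- equality for the single-user types
    MACExponent.typeExponentOpt P₁ P₂ W Q₁ Q₂ .user₁ = MACExponent.FU P₁ P₂ W Q₁ Q₂ .user₁ ∧
    MACExponent.typeExponentOpt P₁ P₂ W Q₁ Q₂ .user₂ = MACExponent.FU P₁ P₂ W Q₁ Q₂ .user₂ := by
  refine ⟨MACExponent.exponent_le hP₁ hP₂, MACExponent.exponentOpt_le hP₁ hP₂,
    MACExponent.typeExponent_le hP₁ hP₂, ?_, ?_⟩
  · exact (MACExponent.typeExponentOpt_le hP₁ hP₂ _).antisymm
      (MACExponent.FU_user₁_le hP₁ hP₂ hW hQ₁ hQ₂)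
  · refine (MACExponent.typeExponentOpt_le hP₁ hP₂ _).antisymm ?_
    rw [MACExponent.typeExponentOpt_user₂, MACExponent.FU_user₂]
    exact MACExponent.FU_user₁_le hP₂ hP₁ (fun x₂ x₁ => hW x₁ x₂) hQ₂ hQ₁
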